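/- Let $K$ be a field of characteristic $0$ and let $L$ be a finite-dimensional semisimple Lie algebra over $K$, i.e. the solvable radical of $L$ is zero. A linear operator $J\colon L\to L$ is called Lie-orthogonal if $[Jx,Jy]=[x,y]$ for all $x,y\in L$. Let $J$ be a Lie-orthogonal operator on $L$. (1) If $L=L_1\oplus\cdots\oplus L_k$ is the decomposition of $L$ into simple components (each $L_i$ is an ideal of $L$ that is a simple Lie algebra, and $L$ is their direct sum), then $J=J_1\oplus\cdots\oplus J_k$ for some operators $J_i$ on $L_i$ such that, for each $i=1,\dots,k$, either $J_i=\mathrm{Id}_{L_i}$ or $J_i=-\mathrm{Id}_{L_i}$. (2) In other words, $L$ is the direct sum of two ideals (one of which may be zero) such that $J$ acts on one of them as $\mathrm{Id}$ and on the other as $-\mathrm{Id}$. -/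

import Mathlib

/-- A linear operator `J` on a Lie algebra `L` is Lie-orthogonal if `[J x, J y] = [x, y]`
for all `x, y` in `L`. -/
def IsLieOrthogonal {K L : Type*} [CommRing K] [LieRing L] [LieAlgebra K L]
    (J : L →ₗ[K] L) : Prop :=
  ∀ x y : L, ⁅J x, J y⁆ = ⁅x, y⁆

/-- A family `I 1, …, I k` of ideals is a decomposition of `L` into simple components if each
`I i` is a simple Lie algebra (in particular non-abelian) and `L` is the (internal) direct sum of
the `I i`. -/
structure IsSimpleDecomposition {K L : Type*} [CommRing K] [LieRing L] [LieAlgebra K L]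
    {k : ℕ} (I : Fin k → LieIdeal K L) : Prop where
  isSimple : ∀ i, LieAlgebra.IsSimple K (I i)
  isInternal : DirectSum.IsInternal fun i => (I i).toSubmodule

theorem bijective_coeLinearMap_of_isInternal {K V : Type*} [CommRing K] [AddCommGroup V]
    [Module K V] {k : ℕ} {W : Fin k → Submodule K V} (hW : DirectSum.IsInternal W) :
    Function.Bijective (DirectSum.coeLinearMap W) :=
  hW

/-- The operator `J 1 ⊕ … ⊕ J k` on `V = W 1 ⊕ … ⊕ W k` built from operators `J i` on the
summands `W i`: split a vector into its components, apply `J i` to the `i`-th component, and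
add up. -/
noncomputable def directSumOperator {K V : Type*} [CommRing K] [AddCommGroup V] [Module K V]
    {k : ℕ} {W : Fin k → Submodule K V} (hW : DirectSum.IsInternal W)
    (J : ∀ i, W i →ₗ[K] W i) : V →ₗ[K] V :=
  DirectSum.coeLinearMap W ∘ₗ DirectSum.lmap J ∘ₗ
    (LinearEquiv.ofBijective (DirectSum.coeLinearMap W)
      (bijective_coeLinearMap_of_isInternal hW)).symm.toLinearMap

namespace IsLieOrthogonal

variable {K L : Type*} [Field K] [LieRing L] [LieAlgebra K L]

/-! The center is zero, so `J` is injective, hence bijective. Orthogonality and cyclic invariance of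
`κ(⁅x, y⁆, z)`, with `κ` nondegenerate, force `J ^ 2 = 1` (`apply_apply`). The `1`- and
`-1`-eigenspaces span `L` and commute, and each is the centralizer of the other, hence an ideal. A
simple ideal lies in one of them. -/

theorem eq_zero_of_forall_lie_eq_zero [LieAlgebra.HasTrivialRadical K L] {x : L}
    (h : ∀ y : L, ⁅x, y⁆ = 0) : x = 0 := by
  have hx : x ∈ LieAlgebra.center K L := (LieModule.mem_maxTrivSubmodule K L L x).2 fun y => by
    rw [← lie_skew, h, neg_zero]
  rwa [LieAlgebra.center_eq_bot, LieSubmodule.mem_bot] at hx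

theorem injective [LieAlgebra.HasTrivialRadical K L] {J : L →ₗ[K] L} (hJ : IsLieOrthogonal J) :
    Function.Injective J := by
  rw [injective_iff_map_eq_zero]
  intro x hx
  refine eq_zero_of_forall_lie_eq_zero (K := K) fun y => ?_
  rw [← hJ x y, hx, zero_lie]

/-- The form `κ(⁅x, y⁆, z)` is invariant under cyclic permutations. -/
theorem killingForm_lie_rotate (x y z : L) :
    killingForm K L ⁅x, y⁆ z = killingForm K L ⁅y, z⁆ x := by
  rw [LieModule.traceForm_apply_lie_apply, LieModule.traceForm_comm]

theorem apply_apply [CharZero K] [FiniteDimensional K L] [LieAlgebra.HasTrivialRadical K L]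
    {J : L →ₗ[K] L} (hJ : IsLieOrthogonal J) (z : L) : J (J z) = z := by
  have hsurj : Function.Surjective J := LinearMap.surjective_of_injective hJ.injective
  have key : ∀ x y, killingForm K L ⁅J (J z), x⁆ y = killingForm K L ⁅z, x⁆ y := by
    intro x y
    -- Writing both arguments as images lets orthogonality strip `J` from any pair that rotation
    -- puts into a bracket.
    obtain ⟨x, rfl⟩ := hsurj x
    obtain ⟨y, rfl⟩ := hsurj y
    calc killingForm K L ⁅J (J z), J x⁆ (J y)
        = killingForm K L ⁅J y, J z⁆ x := by rw [hJ, ← killingForm_lie_rotate]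
      _ = killingForm K L ⁅J x, J y⁆ z := by
        rw [hJ, hJ, killingForm_lie_rotate x y]
      _ = killingForm K L ⁅z, J x⁆ (J y) := (killingForm_lie_rotate ..).symm
  rw [← sub_eq_zero]
  refine eq_zero_of_forall_lie_eq_zero (K := K) fun x => ?_
  have hker : ⁅J (J z) - z, x⁆ ∈ (killingForm K L).ker := by
    rw [LinearMap.mem_ker]
    ext y
    simp [sub_lie, key]
  simpa [LieAlgebra.IsKilling.ker_killingForm_eq_bot] using hker

variable [CharZero K] {J : L →ₗ[K] L}

theorem lie_eq_zero_of_apply_eq_smul (hJ : IsLieOrthogonal J) {ε : K} (hε : ε * ε = 1) {x y : L}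
    (hx : J x = ε • x) (hy : J y = -(ε • y)) : ⁅x, y⁆ = 0 := by
  have : IsAddTorsionFree L := .of_isTorsionFree K L
  have h := hJ x y
  rw [hx, hy, lie_neg, smul_lie, lie_smul, smul_smul, hε, one_smul] at h
  exact self_eq_neg.mp h.symm

theorem exists_eigenvector_add (hinv : ∀ x, J (J x) = x) {ε : K} (hε : ε * ε = 1) (x : L) :
    ∃ p n, x = p + n ∧ J p = ε • p ∧ J n = -(ε • n) := by
  refine ⟨(2⁻¹ : K) • (x + ε • J x), (2⁻¹ : K) • (x - ε • J x), ?_, ?_, ?_⟩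
  · module
  · simp only [map_smul, map_add, hinv]
    match_scalars <;> first | ring1 | linear_combination (-2⁻¹ : K) * hε
  · simp only [map_smul, map_sub, hinv]
    match_scalars <;> first | ring1 | linear_combination (-2⁻¹ : K) * hε

variable [LieAlgebra.HasTrivialRadical K L]

/-- The `-ε`-component `n` of `x` commutes with both eigenspaces, so it is central. -/
theorem apply_eq_smul_of_forall_lie_eq_zero (hJ : IsLieOrthogonal J)
    (hinv : ∀ x, J (J x) = x) {ε : K} (hε : ε * ε = 1) {x : L}
    (h : ∀ y, J y = -(ε • y) → ⁅x, y⁆ = 0) : J x = ε • x := by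
  obtain ⟨p, n, rfl, hp, hn⟩ := exists_eigenvector_add hinv hε x
  have hn0 : n = 0 := by
    refine eq_zero_of_forall_lie_eq_zero (K := K) fun y => ?_
    obtain ⟨q, m, rfl, hq, hm⟩ := exists_eigenvector_add hinv hε y
    have h1 := h m hm
    rw [add_lie, hJ.lie_eq_zero_of_apply_eq_smul hε hp hm, zero_add] at h1
    rw [lie_add, h1, ← lie_skew, hJ.lie_eq_zero_of_apply_eq_smul hε hq hn, neg_zero, add_zero]
  simp [hn0, hp]

/-- The eigenspace of an involutive Lie-orthogonal operator for an eigenvalue `ε` with `ε ^ 2 = 1`,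
as an ideal. -/
def eigenIdeal (hJ : IsLieOrthogonal J) (hinv : ∀ x, J (J x) = x) (ε : K) (hε : ε * ε = 1) :
    LieIdeal K L where
  toSubmodule := Module.End.eigenspace J ε
  lie_mem := by
    intro x m hm
    change m ∈ Module.End.eigenspace J ε at hm
    change ⁅x, m⁆ ∈ Module.End.eigenspace J ε
    rw [Module.End.mem_eigenspace_iff] at hm ⊢
    refine hJ.apply_eq_smul_of_forall_lie_eq_zero hinv hε fun y hy => ?_
    obtain ⟨p, n, rfl, hp, hn⟩ := exists_eigenvector_add hinv hε x
    have hmn : ⁅n, m⁆ = 0 := by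
      rw [← lie_skew, hJ.lie_eq_zero_of_apply_eq_smul hε hm hn, neg_zero]
    -- Jacobi: `y` commutes with both `p` and `m`, hence with `⁅p, m⁆`.
    rw [add_lie, hmn, add_zero, lie_lie, hJ.lie_eq_zero_of_apply_eq_smul hε hm hy,
      hJ.lie_eq_zero_of_apply_eq_smul hε hp hy, lie_zero, lie_zero, sub_zero]

theorem mem_eigenIdeal (hJ : IsLieOrthogonal J) (hinv : ∀ x, J (J x) = x) {ε : K}
    (hε : ε * ε = 1) {x : L} : x ∈ hJ.eigenIdeal hinv ε hε ↔ J x = ε • x :=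
  Module.End.mem_eigenspace_iff

theorem exists_isCompl [FiniteDimensional K L] (hJ : IsLieOrthogonal J) :
    ∃ P N : LieIdeal K L, IsCompl P N ∧ (∀ x ∈ P, J x = x) ∧ (∀ x ∈ N, J x = -x) := by
  have hinv := hJ.apply_apply
  refine ⟨hJ.eigenIdeal hinv 1 (by ring), hJ.eigenIdeal hinv (-1) (by ring), ⟨?_, ?_⟩, ?_, ?_⟩
  · rw [disjoint_iff, LieSubmodule.eq_bot_iff]
    rintro x ⟨hp, hn⟩
    have hp := (hJ.mem_eigenIdeal hinv _).1 hp
    have hn := (hJ.mem_eigenIdeal hinv _).1 hn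
    rw [hp, one_smul, neg_one_smul] at hn
    have : IsAddTorsionFree L := .of_isTorsionFree K L
    exact self_eq_neg.mp hn
  · rw [codisjoint_iff, eq_top_iff]
    intro x _
    obtain ⟨p, n, rfl, hp, hn⟩ := exists_eigenvector_add hinv (ε := (1 : K)) (by ring) x
    rw [LieSubmodule.mem_sup]
    exact ⟨p, (hJ.mem_eigenIdeal hinv _).2 hp, n,
      (hJ.mem_eigenIdeal hinv _).2 (by rw [hn, neg_smul]), rfl⟩
  · intro x hx
    simpa using (hJ.mem_eigenIdeal hinv _).1 hx
  · intro x hx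
    simpa using (hJ.mem_eigenIdeal hinv _).1 hx

theorem eq_or_eq_neg_on_of_isSimple [FiniteDimensional K L] (hJ : IsLieOrthogonal J)
    (I : LieIdeal K L) (hI : LieAlgebra.IsSimple K I) :
    (∀ x ∈ I, J x = x) ∨ (∀ x ∈ I, J x = -x) := by
  have hinv := hJ.apply_apply
  have hone : (1 : K) * 1 = 1 := one_mul 1
  have hneg : (-1 : K) * (-1) = 1 := by ring
  rcases hI.eq_bot_or_eq_top ((hJ.eigenIdeal hinv 1 hone).comap I.incl) with h | h
  · right
    intro x hx
    rw [← neg_one_smul K x]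
    -- With `ε = -1`, `y` is fixed by `J`, so `⁅x, y⁆` lies in `I` and in the `1`-eigenideal, which
    -- meet in zero.
    refine hJ.apply_eq_smul_of_forall_lie_eq_zero hinv hneg fun y hy => ?_
    have hmem : (⟨⁅x, y⁆, lie_mem_left K L I x y hx⟩ : I) ∈
        (hJ.eigenIdeal hinv 1 hone).comap I.incl := by
      rw [LieIdeal.mem_comap]
      refine lie_mem_right K L _ x y ((hJ.mem_eigenIdeal hinv hone).2 ?_)
      simpa using hy
    rw [h, LieSubmodule.mem_bot] at hmem
    exact congrArg Subtype.val hmem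
  · left
    intro x hx
    have hmem : (⟨x, hx⟩ : I) ∈ (hJ.eigenIdeal hinv 1 hone).comap I.incl := by
      rw [h]
      exact LieSubmodule.mem_top _
    rw [LieIdeal.mem_comap] at hmem
    simpa using (hJ.mem_eigenIdeal hinv hone).1 hmem

end IsLieOrthogonal

theorem eq_directSumOperator {K V : Type*} [CommRing K] [AddCommGroup V] [Module K V] {k : ℕ}
    {W : Fin k → Submodule K V} (hW : DirectSum.IsInternal W) (J : V →ₗ[K] V)
    (Jc : ∀ i, W i →ₗ[K] W i) (h : ∀ i (x : W i), J x = Jc i x) :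
    J = directSumOperator hW Jc := by
  have hcomp : J ∘ₗ DirectSum.coeLinearMap W =
      DirectSum.coeLinearMap W ∘ₗ DirectSum.lmap Jc := by
    ext i x
    simp [h]
  ext v
  obtain ⟨w, rfl⟩ := (bijective_coeLinearMap_of_isInternal hW).2 v
  have hw : (LinearEquiv.ofBijective (DirectSum.coeLinearMap W)
      (bijective_coeLinearMap_of_isInternal hW)).symm (DirectSum.coeLinearMap W w) = w :=
    LinearEquiv.ofBijective_symm_apply_apply ..
  simp only [directSumOperator, LinearMap.comp_apply, LinearEquiv.coe_coe, hw]
  exact LinearMap.congr_fun hcomp w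

theorem theorem3 {K L : Type*} [Field K] [CharZero K] [LieRing L] [LieAlgebra K L]
    [FiniteDimensional K L] [LieAlgebra.HasTrivialRadical K L]
    (J : L →ₗ[K] L) (hJ : IsLieOrthogonal J) :
    (∀ (k : ℕ) (I : Fin k → LieIdeal K L) (hI : IsSimpleDecomposition I),
      ∃ Jc : ∀ i, (I i).toSubmodule →ₗ[K] (I i).toSubmodule,
        J = directSumOperator hI.isInternal Jc ∧
          ∀ i, Jc i = LinearMap.id ∨ Jc i = -LinearMap.id) ∧
    (∃ P N : LieIdeal K L, IsCompl P N ∧ (∀ x ∈ P, J x = x) ∧ (∀ x ∈ N, J x = -x)) := by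
  refine ⟨fun k I hI => ?_, hJ.exists_isCompl⟩
  have hex : ∀ i, ∃ f : (I i).toSubmodule →ₗ[K] (I i).toSubmodule,
      (∀ x : (I i).toSubmodule, J x = f x) ∧ (f = LinearMap.id ∨ f = -LinearMap.id) := by
    intro i
    rcases hJ.eq_or_eq_neg_on_of_isSimple (I i) (hI.isSimple i) with h | h
    · exact ⟨LinearMap.id, fun x => by simpa using h x x.2, Or.inl rfl⟩
    · exact ⟨-LinearMap.id, fun x => by simpa using h x x.2, Or.inr rfl⟩
  choose Jc hJc hid using hex
  exact ⟨Jc, eq_directSumOperator hI.isInternal J Jc hJc, hid⟩
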